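/- Let $I_0(\kappa)=\frac1{2\pi}\int_0^{2\pi}e^{\kappa\cos u}\,du$, and let $\mathrm{vonMises}(\theta,\kappa)$ be the distribution on $[0,2\pi)$ with density $x\mapsto e^{\kappa\cos(x-\theta)}/(2\pi I_0(\kappa))$; intervals of angles are understood modulo $2\pi$. For each $N$ let $K=K_N\in\{0,\dots,N\}$ and $\kappa=\kappa_N>0$. In the von Mises flat model with parameters $(N,K,\kappa)$, angles $X_1,\dots,X_N\in[0,2\pi)$ are observed. Under the null hypothesis $H_0$ (law $\mathbb Q_N$) they are independent and uniform on $[0,2\pi)$. Under the alternative $H_1$ (law $\mathbb P_N$) a subset $S^*\subseteq\{1,\dots,N\}$ is drawn uniformly among those of size $K$, a phase $\Theta^*$ is drawn independently and uniformly from $[0,2\pi)$, and given $(S^*,\Theta^*)$ the angles are independent with $X_i\sim\mathrm{vonMises}(\Theta^*,\kappa)$ for $i\in S^*$ and $X_i$ uniform on $[0,2\pi)$ for $i\notin S^*$. For a test (a measurable function of the data with values in $\{0,1\}$, where $1$ means that $H_0$ is rejected) put $p_{\mathrm{fa}}(\phi)=\mathbb Q_N\{\phi(X)=1\}$ and $p_{\mathrm{miss}}(\phi)=\mathbb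 P_N\{\phi(X)=0\}$. All limits are as $N\to\infty$. (a) (Achievability) Let $\tau=\tau_N\in(0,1)$, let $p_\kappa(\tau)$ be the mass that $\mathrm{vonMises}(0,\kappa)$ gives to $[-\pi\tau,\pi\tau]$ (modulo $2\pi$), and let $g=K\,(p_\kappa(\tau)-\tau)$. Suppose that $c_N\to\infty$ is a sequence such that, with $$\gamma_N=N\tau+g-c_N\sqrt{N\tau+g},$$ one has $\gamma_N\ge 1+(N-1)\tau$ for all sufficiently large $N$, $$\frac{g^2}{N\tau+g}\to\infty\qquad\text{and}\qquad\frac{\big(g-c_N\sqrt{N\tau+g}\big)^2}{2N\tau+g-c_N\sqrt{N\tau+g}}-\log N\to\infty.$$ Then the interval test $\phi_N$ with window length $2\pi\tau$ and threshold $\gamma_N$, which rejects $H_0$ if and only if $$\sup_{\theta\in[0,2\pi)}\#\{i: X_i\in[\theta,\theta+2\pi\tau]\ (\mathrm{mod}\ 2\pi)\}\ \ge\ \gamma_N,$$ achieves strong detection: $p_{\mathrm{fa}}(\phi_N)\to0$ and $p_{\mathrm{miss}}(\phi_N)\to0$. (b) (Converse) Let $R(\kappa)=I_0(2\kappa)/I_0(\kappa)^2$.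 If $$\frac{K^2}{N}\big(R(\kappa)-1\big)-\log R(\kappa)\to-\infty,$$ then weak detection is impossible: for every sequence of tests $(\phi_N)$, $p_{\mathrm{fa}}(\phi_N)+p_{\mathrm{miss}}(\phi_N)\ge 1-o(1)$. -/

import Mathlib

open MeasureTheory Filter Topology
open scoped ENNReal

namespace CircularDetection

noncomputable section

/-- The modified Bessel function of the first kind of order zero,
`I₀(κ) = (1 / 2π) ∫₀^{2π} exp (κ cos u) du`. -/
def besselI0 (κ : ℝ) : ℝ :=
  (2 * Real.pi)⁻¹ * ∫ u in (0 : ℝ)..(2 * Real.pi), Real.exp (κ * Real.cos u)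

/-- The ratio `R(κ) = I₀(2κ) / I₀(κ)²`. -/
def ratioR (κ : ℝ) : ℝ := besselI0 (2 * κ) / besselI0 κ ^ 2

/-- The uniform distribution on `[0, 2π)`, as a measure on `ℝ`. -/
def uniformAngle : Measure ℝ :=
  ENNReal.ofReal (2 * Real.pi)⁻¹ • volume.restrict (Set.Ico 0 (2 * Real.pi))

/-- The von Mises distribution with location `θ` and concentration `κ`: the measure on `[0, 2π)`
with density `x ↦ exp (κ cos (x - θ)) / (2π I₀(κ))`. -/
def vonMises (θ κ : ℝ) : Measure ℝ :=
  (volume.restrict (Set.Ico 0 (2 * Real.pi))).withDensity fun x =>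
    ENNReal.ofReal (Real.exp (κ * Real.cos (x - θ)) / (2 * Real.pi * besselI0 κ))

/-- The closed arc from `a` to `b`: the angles that are congruent modulo `2π` to a point
of `[a, b]`. -/
def arc (a b : ℝ) : Set ℝ :=
  {x | ∃ m : ℤ, x + 2 * Real.pi * m ∈ Set.Icc a b}

/-- `p_κ(τ)`: the mass that the von Mises distribution with location `0` and concentration `κ`
gives to the arc `[-πτ, πτ]`. -/
def vonMisesMass (κ τ : ℝ) : ℝ :=
  (vonMises 0 κ).real (arc (-(Real.pi * τ)) (Real.pi * τ))

/-- `g = K (p_κ(τ) - τ)`. -/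
def gain (K : ℕ) (κ τ : ℝ) : ℝ := K * (vonMisesMass κ τ - τ)

/-- The law of the data under the null hypothesis: `N` independent uniform angles. -/
def nullLaw (N : ℕ) : Measure (Fin N → ℝ) := Measure.pi fun _ => uniformAngle

open Classical in
/-- The conditional law of the data given the planted set `S` and the planted phase `θ`:
independent angles, von Mises for the indices in `S` and uniform for the others. -/
def plantedLaw (N : ℕ) (κ : ℝ) (S : Finset (Fin N)) (θ : ℝ) : Measure (Fin N → ℝ) :=
  Measure.pi fun i => if i ∈ S then vonMises θ κ else uniformAngle

/-- The law of the data under the alternative in the von Mises flat model `(N, K, κ)`: the mixture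
of the conditional laws, where the planted set is uniform among the subsets of size `K` and the
planted phase is independent of it and uniform on `[0, 2π)`. -/
def altLaw (N K : ℕ) (κ : ℝ) : Measure (Fin N → ℝ) :=
  ((N.choose K : ℝ≥0∞))⁻¹ •
    ∑ S ∈ (Finset.univ : Finset (Fin N)).powersetCard K,
      uniformAngle.bind fun θ => plantedLaw N κ S θ

/-- The false alarm probability of a test (`true` means that the null hypothesis is rejected) when
`Q` is the law of the data under the null hypothesis. -/
def pFalseAlarm {N : ℕ} (Q : Measure (Fin N → ℝ)) (φ : (Fin N → ℝ) → Bool) : ℝ :=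
  Q.real {x | φ x = true}

/-- The miss probability of a test when `P` is the law of the data under the alternative. -/
def pMiss {N : ℕ} (P : Measure (Fin N → ℝ)) (φ : (Fin N → ℝ) → Bool) : ℝ :=
  P.real {x | φ x = false}

/-- The sequence `φ` consists of tests (measurable functions) and achieves strong detection. -/
def AchievesStrongDetection (Q P : (N : ℕ) → Measure (Fin N → ℝ))
    (φ : (N : ℕ) → (Fin N → ℝ) → Bool) : Prop :=
  (∀ N, Measurable (φ N)) ∧
    Tendsto (fun N => pFalseAlarm (Q N) (φ N)) atTop (𝓝 0) ∧
    Tendsto (fun N => pMiss (P N) (φ N)) atTop (𝓝 0)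

/-- Weak detection is impossible: every sequence of tests has a sum of error probabilities which
is at least `1 - o(1)`. -/
def WeakDetectionImpossible (Q P : (N : ℕ) → Measure (Fin N → ℝ)) : Prop :=
  ∀ φ : (N : ℕ) → (Fin N → ℝ) → Bool, (∀ N, Measurable (φ N)) →
    ∃ r : ℕ → ℝ, Tendsto r atTop (𝓝 0) ∧
      ∀ N, 1 - r N ≤ pFalseAlarm (Q N) (φ N) + pMiss (P N) (φ N)

open Classical in
/-- The interval statistic: the supremum over `θ ∈ [0, 2π)` of the number of observations in the
arc `[θ, θ + 2πτ]`. -/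
def intervalStat {N : ℕ} (τ : ℝ) (x : Fin N → ℝ) : ℕ :=
  ⨆ θ : Set.Ico (0 : ℝ) (2 * Real.pi),
    (Finset.univ.filter fun i : Fin N => x i ∈ arc θ (θ + 2 * Real.pi * τ)).card

open Classical in
/-- The interval test with window length `2πτ` and threshold `γ`: it rejects the null hypothesis
if and only if the interval statistic is at least `γ`. -/
def intervalTest (N : ℕ) (τ γ : ℝ) (x : Fin N → ℝ) : Bool :=
  decide (γ ≤ (intervalStat τ x : ℝ))

/-- The threshold `N τ + g - c √(N τ + g)`. -/
def threshold (N K : ℕ) (κ τ c : ℝ) : ℝ :=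
  N * τ + gain K κ τ - c * √(N * τ + gain K κ τ)

end

end CircularDetection

namespace CircularDetection

/-! ### Products of nonnegative functions of independent coordinates -/

/-! Achievability. Sliding a window forward until it starts at the first observation inside it loses
no observation, so the supremum over all windows is attained at one of the N windows starting at an
observation (`exists_windowCount_le_self`). Under the null, the window at X_i contains X_i and each
of the other N - 1 angles independently with probability τ. A Chernoff bound for this count and a
union bound over i control false alarms; the union bound is what log N pays for. Under the
alternative, the window centred at the planted phase has mean count Nτ + g and variance at most its
mean, so Chebyshev bounds the miss probability by 1/c² (`plantedLaw_intervalStat_lt_le`).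

Converse. Let L be the likelihood ratio. By Tonelli its second moment under the null is the average
of o(θ, θ')^|S ∩ S'| over two independent copies of the planted pair, where o is the overlap of two
von Mises densities. Since o ≤ R and o has average 1, the average of o^m is at most R^(m-1) for m ≥
1 (`lintegral_overlap_pow_le`); the factor R saved here becomes -log R in the hypothesis. The
exponential moment of the hypergeometric variable |S ∩ S'| is at most that of a binomial one
(`sum_pow_card_inter_le`), so E L² ≤ 1 + exp(K²(R - 1)/N - log R) = 1 + o(1). A likelihood ratio
with vanishing variance separates no event (`sq_withDensity_sub_le`). -/

theorem lintegral_pi_prod {ι : Type*} [Fintype ι] {Ω : ι → Type*}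
    [∀ i, MeasurableSpace (Ω i)] (μ : ∀ i, Measure (Ω i)) [∀ i, IsProbabilityMeasure (μ i)]
    (f : ∀ i, Ω i → ℝ≥0∞) (hf : ∀ i, Measurable (f i)) :
    ∫⁻ x, ∏ i, f i (x i) ∂Measure.pi μ = ∏ i, ∫⁻ y, f i y ∂μ i := by
  have h := ProbabilityTheory.lintegral_prod_eq_prod_lintegral_of_indepFun
    (μ := Measure.pi μ) Finset.univ (fun i (x : ∀ i, Ω i) => f i (x i))
    (ProbabilityTheory.iIndepFun_pi fun i => (hf i).aemeasurable)
    (fun i => (hf i).comp (measurable_pi_apply i))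
  rw [h]
  exact Finset.prod_congr rfl fun i _ =>
    (measurePreserving_eval μ i).lintegral_comp (hf i)

theorem pi_withDensity {ι : Type*} [Fintype ι] {Ω : ι → Type*}
    [∀ i, MeasurableSpace (Ω i)] (μ : ∀ i, Measure (Ω i)) [∀ i, IsProbabilityMeasure (μ i)]
    (f : ∀ i, Ω i → ℝ≥0∞) (hf : ∀ i, Measurable (f i))
    [∀ i, SigmaFinite ((μ i).withDensity (f i))] :
    Measure.pi (fun i => (μ i).withDensity (f i)) =
      (Measure.pi μ).withDensity fun x => ∏ i, f i (x i) := by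
  refine Measure.pi_eq fun s hs => ?_
  rw [withDensity_apply _ (MeasurableSet.univ_pi hs),
    ← lintegral_indicator (MeasurableSet.univ_pi hs)]
  have h : (Set.univ.pi s).indicator (fun x : ∀ i, Ω i => ∏ i, f i (x i)) =
      fun x => ∏ i, (s i).indicator (f i) (x i) := by
    classical
    funext x
    by_cases hx : x ∈ Set.univ.pi s
    · rw [Set.indicator_of_mem hx]
      exact Finset.prod_congr rfl fun i _ => (Set.indicator_of_mem (hx i trivial) _).symm
    · rw [Set.indicator_of_notMem hx]
      obtain ⟨i, hi⟩ : ∃ i, x i ∉ s i := by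
        by_contra! h
        exact hx fun i _ => h i
      exact (Finset.prod_eq_zero (Finset.mem_univ i) (Set.indicator_of_notMem hi _)).symm
  rw [h, lintegral_pi_prod μ _ fun i => (hf i).indicator (hs i)]
  exact Finset.prod_congr rfl fun i _ => by
    rw [withDensity_apply _ (hs i), lintegral_indicator (hs i)]

/-! ### The uniform distribution on the circle -/

instance isProbabilityMeasure_uniformAngle : IsProbabilityMeasure uniformAngle := by
  constructor
  have h : (0 : ℝ) < 2 * Real.pi := by positivity
  rw [uniformAngle, Measure.smul_apply, Measure.restrict_apply_univ, Real.volume_Ico, sub_zero,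
    smul_eq_mul, ← ENNReal.ofReal_mul (by positivity), inv_mul_cancel₀ h.ne', ENNReal.ofReal_one]

/-- Rotation invariance, without reducing angles modulo 2π: for periodic F any two intervals of
length 2π are fundamental domains of the same translation group. -/
theorem lintegral_uniformAngle_comp_sub {F : ℝ → ℝ≥0∞}
    (hF : Function.Periodic F (2 * Real.pi)) (θ : ℝ) :
    ∫⁻ x, F (x - θ) ∂uniformAngle = ∫⁻ x, F x ∂uniformAngle := by
  have hpi : (0 : ℝ) < 2 * Real.pi := by positivity
  have key (G : ℝ → ℝ≥0∞) : ∫⁻ x, G x ∂uniformAngle =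
      ENNReal.ofReal (2 * Real.pi)⁻¹ * ∫⁻ x in Set.Ioc 0 (0 + 2 * Real.pi), G x := by
    rw [uniformAngle, lintegral_smul_measure, smul_eq_mul, zero_add,
      Measure.restrict_congr_set Ico_ae_eq_Ioc]
  rw [key, key]
  congr 1
  have h1 : ∫⁻ x in Set.Ioc 0 (0 + 2 * Real.pi), F (x - θ) =
      ∫⁻ x in Set.Ioc (-θ) (-θ + 2 * Real.pi), F x := by
    rw [← lintegral_indicator measurableSet_Ioc, ← lintegral_indicator measurableSet_Ioc,
      ← lintegral_sub_right_eq_self ((Set.Ioc (-θ) (-θ + 2 * Real.pi)).indicator F) θ]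
    congr 1
    funext x
    simp only [Set.indicator, Set.mem_Ioc]
    congr 1
    apply propext
    constructor <;> rintro ⟨h, h'⟩ <;> constructor <;> linarith
  rw [h1]
  refine (isAddFundamentalDomain_Ioc hpi (-θ)).setLIntegral_eq
    (isAddFundamentalDomain_Ioc hpi 0) F ?_
  rintro ⟨g, hg⟩ x
  obtain ⟨n, rfl⟩ := AddSubgroup.mem_zmultiples_iff.1 hg
  change F (n • (2 * Real.pi) + x) = F x
  rw [add_comm]
  exact hF.zsmul n x

/-! ### The von Mises density relative to the uniform distribution -/

theorem besselI0_pos (κ : ℝ) : 0 < besselI0 κ := by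
  refine mul_pos (by positivity) ?_
  exact intervalIntegral.intervalIntegral_pos_of_pos
    (Continuous.intervalIntegrable (by fun_prop) _ _) (fun _ => Real.exp_pos _) (by positivity)

theorem lintegral_exp_mul_cos (κ θ : ℝ) :
    ∫⁻ x, ENNReal.ofReal (Real.exp (κ * Real.cos (x - θ))) ∂uniformAngle =
      ENNReal.ofReal (besselI0 κ) := by
  have hpi : (0 : ℝ) < 2 * Real.pi := by positivity
  rw [lintegral_uniformAngle_comp_sub (F := fun x => ENNReal.ofReal (Real.exp (κ * Real.cos x)))
    (fun x => by simp only [Real.cos_add_two_pi])]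
  rw [uniformAngle, lintegral_smul_measure, besselI0, smul_eq_mul,
    ENNReal.ofReal_mul (by positivity), Measure.restrict_congr_set Ico_ae_eq_Ioc,
    intervalIntegral.integral_of_le hpi.le, ofReal_integral_eq_lintegral_ofReal]
  · exact (Continuous.intervalIntegrable (by fun_prop) _ _ :
      IntervalIntegrable (fun u => Real.exp (κ * Real.cos u)) volume 0 (2 * Real.pi)).1
  · exact ae_of_all _ fun _ => (Real.exp_pos _).le

/-- The density of `vonMises θ κ` relative to the uniform distribution. -/
noncomputable def relDensity (κ θ x : ℝ) : ℝ≥0∞ :=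
  ENNReal.ofReal (Real.exp (κ * Real.cos (x - θ)) / besselI0 κ)

@[fun_prop]
theorem measurable_relDensity {α : Type*} [MeasurableSpace α] {f g : α → ℝ} (κ : ℝ)
    (hf : Measurable f) (hg : Measurable g) : Measurable fun a => relDensity κ (f a) (g a) := by
  unfold relDensity
  fun_prop

theorem relDensity_comm (κ θ x : ℝ) : relDensity κ θ x = relDensity κ x θ := by
  rw [relDensity, relDensity, ← Real.cos_neg, neg_sub]

theorem vonMises_eq_withDensity (θ κ : ℝ) :
    vonMises θ κ = uniformAngle.withDensity (relDensity κ θ) := by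
  have hm : Measurable (relDensity κ θ) := by fun_prop
  rw [uniformAngle, withDensity_smul_measure, vonMises, ← withDensity_smul _ hm]
  congr 1
  funext x
  rw [Pi.smul_apply, smul_eq_mul, relDensity, ← ENNReal.ofReal_mul (by positivity)]
  congr 1
  have := besselI0_pos κ
  field_simp

theorem lintegral_relDensity (κ θ : ℝ) : ∫⁻ x, relDensity κ θ x ∂uniformAngle = 1 := by
  have h := besselI0_pos κ
  have h2 : ∀ x, relDensity κ θ x =
      ENNReal.ofReal (Real.exp (κ * Real.cos (x - θ))) * ENNReal.ofReal (besselI0 κ)⁻¹ := by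
    intro x
    rw [relDensity, div_eq_mul_inv, ENNReal.ofReal_mul (Real.exp_pos _).le]
  simp_rw [h2]
  rw [lintegral_mul_const _ (by fun_prop), lintegral_exp_mul_cos, ← ENNReal.ofReal_mul h.le,
    mul_inv_cancel₀ h.ne', ENNReal.ofReal_one]

theorem lintegral_relDensity_left (κ x : ℝ) : ∫⁻ θ, relDensity κ θ x ∂uniformAngle = 1 := by
  simp_rw [relDensity_comm κ _ x]
  exact lintegral_relDensity κ x

/-- The source of R: squaring exp(κ cos) doubles κ, which turns the normalising integral into
I₀(2κ). -/
theorem lintegral_relDensity_sq (κ θ : ℝ) :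
    ∫⁻ x, relDensity κ θ x ^ 2 ∂uniformAngle = ENNReal.ofReal (ratioR κ) := by
  have h := besselI0_pos κ
  have h2 : ∀ x, relDensity κ θ x ^ 2 = ENNReal.ofReal (Real.exp (2 * κ * Real.cos (x - θ))) *
      ENNReal.ofReal (besselI0 κ ^ 2)⁻¹ := by
    intro x
    rw [relDensity, ← ENNReal.ofReal_pow (by positivity), ← ENNReal.ofReal_mul (Real.exp_pos _).le,
      div_pow, ← Real.exp_nat_mul, div_eq_mul_inv]
    push_cast
    rw [mul_assoc]
  simp_rw [h2]
  rw [lintegral_mul_const _ (by fun_prop), lintegral_exp_mul_cos,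
    ← ENNReal.ofReal_mul (besselI0_pos _).le, ratioR, div_eq_mul_inv]

theorem two_mul_le_sq_add_sq (a b : ℝ≥0∞) : 2 * (a * b) ≤ a ^ 2 + b ^ 2 := by
  by_cases ha : a = ∞
  · simp [ha]
  by_cases hb : b = ∞
  · simp [hb]
  lift a to NNReal using ha
  lift b to NNReal using hb
  rw [← mul_assoc]
  exact_mod_cast _root_.two_mul_le_add_sq a b

/-- The overlap integral of two von Mises densities. -/
noncomputable def overlap (κ θ θ' : ℝ) : ℝ≥0∞ :=
  ∫⁻ x, relDensity κ θ x * relDensity κ θ' x ∂uniformAngle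

@[fun_prop]
theorem measurable_overlap {α : Type*} [MeasurableSpace α] {f g : α → ℝ} (κ : ℝ)
    (hf : Measurable f) (hg : Measurable g) : Measurable fun a => overlap κ (f a) (g a) := by
  unfold overlap
  refine Measurable.lintegral_prod_right' (f := fun q : α × ℝ =>
    relDensity κ (f q.1) q.2 * relDensity κ (g q.1) q.2) ?_
  fun_prop

/-- 2ab ≤ a² + b² does the work of Cauchy–Schwarz, because both densities have the same second
moment R. -/
theorem overlap_le (κ θ θ' : ℝ) : overlap κ θ θ' ≤ ENNReal.ofReal (ratioR κ) := by
  have hm (t : ℝ) : Measurable (relDensity κ t) := by fun_prop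
  have h : 2 * overlap κ θ θ' ≤ 2 * ENNReal.ofReal (ratioR κ) := by
    calc 2 * overlap κ θ θ'
        = ∫⁻ x, 2 * (relDensity κ θ x * relDensity κ θ' x) ∂uniformAngle := by
          rw [overlap, lintegral_const_mul _ (by fun_prop)]
      _ ≤ ∫⁻ x, (relDensity κ θ x ^ 2 + relDensity κ θ' x ^ 2) ∂uniformAngle :=
          lintegral_mono fun x => two_mul_le_sq_add_sq _ _
      _ = 2 * ENNReal.ofReal (ratioR κ) := by
          rw [lintegral_add_left ((hm _).pow_const 2), lintegral_relDensity_sq,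
            lintegral_relDensity_sq, two_mul]
  exact (ENNReal.mul_le_mul_iff_right (by simp) (by simp)).1 h

theorem one_le_ratioR (κ : ℝ) : 1 ≤ ratioR κ := by
  have hm : Measurable (relDensity κ 0) := by fun_prop
  have h : (2 : ℝ≥0∞) ≤ ENNReal.ofReal (ratioR κ) + 1 := by
    calc (2 : ℝ≥0∞) = ∫⁻ x, 2 * (relDensity κ 0 x * 1) ∂uniformAngle := by
          simp_rw [mul_one]
          rw [lintegral_const_mul _ hm, lintegral_relDensity, mul_one]
      _ ≤ ∫⁻ x, (relDensity κ 0 x ^ 2 + 1 ^ 2) ∂uniformAngle :=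
          lintegral_mono fun x => two_mul_le_sq_add_sq _ _
      _ = ENNReal.ofReal (ratioR κ) + 1 := by
          rw [lintegral_add_left (hm.pow_const 2), lintegral_relDensity_sq]
          simp
  have h1 : (1 : ℝ≥0∞) ≤ ENNReal.ofReal (ratioR κ) := by
    rw [← one_add_one_eq_two] at h
    exact (ENNReal.add_le_add_iff_right (by simp)).1 h
  exact ENNReal.one_le_ofReal.1 h1

/-- A von Mises law with uniform phase is uniform, so averaging over θ' first replaces one density
by 1. -/
theorem lintegral_lintegral_overlap (κ : ℝ) :
    ∫⁻ θ, ∫⁻ θ', overlap κ θ θ' ∂uniformAngle ∂uniformAngle = 1 := by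
  have h (θ : ℝ) : ∫⁻ θ', overlap κ θ θ' ∂uniformAngle = 1 := by
    unfold overlap
    rw [lintegral_lintegral_swap]
    · have (x : ℝ) : ∫⁻ θ', relDensity κ θ x * relDensity κ θ' x ∂uniformAngle =
          relDensity κ θ x := by
        rw [lintegral_const_mul _ (by fun_prop),
          lintegral_relDensity_left, mul_one]
      simp_rw [this]
      exact lintegral_relDensity κ θ
    · fun_prop
  simp [h]

instance isProbabilityMeasure_vonMises (θ κ : ℝ) : IsProbabilityMeasure (vonMises θ κ) := by
  constructor
  rw [vonMises_eq_withDensity, withDensity_apply _ MeasurableSet.univ, setLIntegral_univ,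
    lintegral_relDensity]

/-! ### The likelihood ratio -/

instance isProbabilityMeasure_nullLaw (N : ℕ) : IsProbabilityMeasure (nullLaw N) := by
  unfold nullLaw
  infer_instance

instance isProbabilityMeasure_plantedLaw (N : ℕ) (κ : ℝ) (S : Finset (Fin N)) (θ : ℝ) :
    IsProbabilityMeasure (plantedLaw N κ S θ) := by
  have (i : Fin N) : IsProbabilityMeasure
      (if i ∈ S then vonMises θ κ else uniformAngle) := by
    split_ifs <;> infer_instance
  unfold plantedLaw
  convert! (inferInstance : IsProbabilityMeasure
    (Measure.pi fun i => if i ∈ S then vonMises θ κ else uniformAngle))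

theorem plantedLaw_eq_withDensity (N : ℕ) (κ : ℝ) (S : Finset (Fin N)) (θ : ℝ) :
    plantedLaw N κ S θ =
      (nullLaw N).withDensity fun x => ∏ i ∈ S, relDensity κ θ (x i) := by
  let f : Fin N → ℝ → ℝ≥0∞ := fun i => if i ∈ S then relDensity κ θ else 1
  have hf (i : Fin N) : Measurable (f i) := by
    by_cases hi : i ∈ S
    · simp only [f, hi, if_true]; fun_prop
    · simp only [f, hi, if_false]; exact measurable_one
  have hU (i : Fin N) : (if i ∈ S then vonMises θ κ else uniformAngle) =
      uniformAngle.withDensity (f i) := by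
    by_cases hi : i ∈ S
    · simp only [f, hi, if_true, vonMises_eq_withDensity]
    · simp only [f, hi, if_false, withDensity_one]
  have hP (i : Fin N) : IsProbabilityMeasure (uniformAngle.withDensity (f i)) := by
    rw [← hU i]
    split_ifs <;> infer_instance
  have h1 : plantedLaw N κ S θ = Measure.pi fun i => uniformAngle.withDensity (f i) := by
    rw [plantedLaw]
    congr 1
    funext i
    rw [← hU i]
  rw [h1, pi_withDensity _ f hf, nullLaw]
  congr 1
  funext x
  rw [← Finset.prod_subset (Finset.subset_univ S) (f := fun i => f i (x i))
    (fun i _ hi => by simp [f, hi])]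
  exact Finset.prod_congr rfl fun i hi => by simp [f, hi]

@[fun_prop]
theorem measurable_prod_relDensity {α : Type*} [MeasurableSpace α] {N : ℕ} (κ : ℝ)
    (S : Finset (Fin N)) {f : α → ℝ} {g : α → Fin N → ℝ} (hf : Measurable f) (hg : Measurable g) :
    Measurable fun a => ∏ i ∈ S, relDensity κ (f a) (g a i) :=
  Finset.measurable_fun_prod S fun i _ => by fun_prop

/-- Needed to evaluate the `bind` over the phase in `altLaw`. -/
theorem measurable_plantedLaw (N : ℕ) (κ : ℝ) (S : Finset (Fin N)) :
    Measurable (plantedLaw N κ S) := by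
  refine Measure.measurable_of_measurable_coe _ fun A hA => ?_
  simp_rw [plantedLaw_eq_withDensity, withDensity_apply _ hA]
  refine Measurable.lintegral_prod_right' (f := fun q : ℝ × (Fin N → ℝ) =>
    ∏ i ∈ S, relDensity κ q.1 (q.2 i)) ?_
  fun_prop

theorem altLaw_apply (N K : ℕ) (κ : ℝ) {A : Set (Fin N → ℝ)} (hA : MeasurableSet A) :
    altLaw N K κ A = ((N.choose K : ℝ≥0∞))⁻¹ *
      ∑ S ∈ (Finset.univ : Finset (Fin N)).powersetCard K,
        ∫⁻ θ, plantedLaw N κ S θ A ∂uniformAngle := by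
  rw [altLaw, Measure.smul_apply, smul_eq_mul, Measure.finsetSum_apply]
  congr 1
  exact Finset.sum_congr rfl fun S _ =>
    Measure.bind_apply hA (measurable_plantedLaw N κ S).aemeasurable

theorem choose_inv_mul_choose {N K : ℕ} (h : K ≤ N) :
    ((N.choose K : ℝ≥0∞))⁻¹ * N.choose K = 1 :=
  ENNReal.inv_mul_cancel (by exact_mod_cast (Nat.choose_pos h).ne') (by simp)

theorem altLaw_apply_le {N K : ℕ} (hK : K ≤ N) (κ : ℝ) {A : Set (Fin N → ℝ)}
    (hA : MeasurableSet A) {b : ℝ≥0∞}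
    (hb : ∀ S : Finset (Fin N), S.card = K → ∀ θ, plantedLaw N κ S θ A ≤ b) :
    altLaw N K κ A ≤ b := by
  rw [altLaw_apply N K κ hA]
  calc _ ≤ ((N.choose K : ℝ≥0∞))⁻¹ *
        ∑ S ∈ (Finset.univ : Finset (Fin N)).powersetCard K, b := by
        refine mul_le_mul_right (Finset.sum_le_sum fun S hS => ?_) _
        calc _ ≤ ∫⁻ _, b ∂uniformAngle :=
              lintegral_mono fun θ => hb S (Finset.mem_powersetCard.1 hS).2 θ
          _ = b := by simp
    _ = b := by
        rw [Finset.sum_const, Finset.card_powersetCard, Finset.card_univ, Fintype.card_fin,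
          nsmul_eq_mul, ← mul_assoc, choose_inv_mul_choose hK, one_mul]

theorem isProbabilityMeasure_altLaw {N K : ℕ} (hK : K ≤ N) (κ : ℝ) :
    IsProbabilityMeasure (altLaw N K κ) := by
  constructor
  rw [altLaw_apply N K κ MeasurableSet.univ]
  simp [choose_inv_mul_choose hK]

/-- The likelihood ratio of the alternative to the null hypothesis. -/
noncomputable def likelihoodRatio (N K : ℕ) (κ : ℝ) (x : Fin N → ℝ) : ℝ≥0∞ :=
  ((N.choose K : ℝ≥0∞))⁻¹ * ∑ S ∈ (Finset.univ : Finset (Fin N)).powersetCard K,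
    ∫⁻ θ, ∏ i ∈ S, relDensity κ θ (x i) ∂uniformAngle

theorem measurable_lintegral_prod_relDensity {N : ℕ} (κ : ℝ) (S : Finset (Fin N)) :
    Measurable fun x : Fin N → ℝ => ∫⁻ θ, ∏ i ∈ S, relDensity κ θ (x i) ∂uniformAngle := by
  refine Measurable.lintegral_prod_right' (f := fun q : (Fin N → ℝ) × ℝ =>
    ∏ i ∈ S, relDensity κ q.2 (q.1 i)) ?_
  fun_prop

theorem measurable_likelihoodRatio (N K : ℕ) (κ : ℝ) : Measurable (likelihoodRatio N K κ) :=
  (Finset.measurable_fun_sum _ fun S _ => measurable_lintegral_prod_relDensity κ S).const_mul _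

theorem altLaw_eq_withDensity (N K : ℕ) (κ : ℝ) :
    altLaw N K κ = (nullLaw N).withDensity (likelihoodRatio N K κ) := by
  ext A hA
  rw [altLaw_apply N K κ hA, withDensity_apply _ hA]
  unfold likelihoodRatio
  rw [lintegral_const_mul _
    (Finset.measurable_fun_sum _ fun S _ => measurable_lintegral_prod_relDensity κ S),
    lintegral_finsetSum _ fun S _ => measurable_lintegral_prod_relDensity κ S]
  congr 1
  refine Finset.sum_congr rfl fun S _ => ?_
  rw [lintegral_lintegral_swap (by fun_prop)]
  exact lintegral_congr fun θ => by rw [plantedLaw_eq_withDensity, withDensity_apply _ hA]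

/-! ### The second moment of the likelihood ratio -/

/-- Coordinates are independent: one in both sets contributes the overlap, one in exactly one set
the total mass 1 of a density, the others 1. -/
theorem lintegral_prod_mul_prod_relDensity {N : ℕ} (κ : ℝ) (S S' : Finset (Fin N)) (θ θ' : ℝ) :
    ∫⁻ x, (∏ i ∈ S, relDensity κ θ (x i)) * ∏ i ∈ S', relDensity κ θ' (x i) ∂nullLaw N =
      overlap κ θ θ' ^ (S ∩ S').card := by
  let f (T : Finset (Fin N)) (t : ℝ) (i : Fin N) : ℝ → ℝ≥0∞ :=
    if i ∈ T then relDensity κ t else 1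
  have hf (T : Finset (Fin N)) (t : ℝ) (i : Fin N) : Measurable (f T t i) := by
    by_cases hi : i ∈ T
    · simp only [f, hi, if_true]; fun_prop
    · simp only [f, hi, if_false]; exact measurable_one
  have hprod (T : Finset (Fin N)) (t : ℝ) (x : Fin N → ℝ) :
      ∏ i ∈ T, relDensity κ t (x i) = ∏ i, f T t i (x i) := by
    rw [← Finset.prod_subset (Finset.subset_univ T) (f := fun i => f T t i (x i))
      (fun i _ hi => by simp [f, hi])]
    exact Finset.prod_congr rfl fun i hi => by simp [f, hi]
  simp_rw [hprod, ← Finset.prod_mul_distrib]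
  rw [nullLaw, lintegral_pi_prod _ (fun i y => f S θ i y * f S' θ' i y)
    fun i => (hf S θ i).mul (hf S' θ' i)]
  rw [← Finset.prod_const, ← Finset.prod_subset (Finset.subset_univ (S ∩ S'))]
  · refine Finset.prod_congr rfl fun i hi => ?_
    obtain ⟨h, h'⟩ := Finset.mem_inter.1 hi
    simp [f, h, h', overlap]
  · intro i _ hi
    by_cases h : i ∈ S
    · have h' : i ∉ S' := fun h' => hi (Finset.mem_inter.2 ⟨h, h'⟩)
      simp [f, h, h', lintegral_relDensity]
    · by_cases h' : i ∈ S'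
      · simp [f, h, h', lintegral_relDensity]
      · simp [f, h, h']

/-- For m ≥ 1 one factor is kept and averages to 1, while the other m - 1 are bounded by R. The
summand 1 covers m = 0 and makes the bound linear in R^m, ready to be summed over S'. -/
theorem lintegral_overlap_pow_le (κ : ℝ) (m : ℕ) :
    ∫⁻ θ, ∫⁻ θ', overlap κ θ θ' ^ m ∂uniformAngle ∂uniformAngle ≤
      ENNReal.ofReal (1 + ratioR κ ^ m / ratioR κ) := by
  have hR : 1 ≤ ratioR κ := one_le_ratioR κ
  have hR0 : 0 < ratioR κ := by linarith
  cases m with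
  | zero =>
    simp only [pow_zero, lintegral_const, measure_univ, mul_one]
    rw [← ENNReal.ofReal_one]
    exact ENNReal.ofReal_le_ofReal (by simp [hR0.le])
  | succ m =>
    calc ∫⁻ θ, ∫⁻ θ', overlap κ θ θ' ^ (m + 1) ∂uniformAngle ∂uniformAngle
        ≤ ∫⁻ θ, ∫⁻ θ', ENNReal.ofReal (ratioR κ) ^ m * overlap κ θ θ'
            ∂uniformAngle ∂uniformAngle := by
          refine lintegral_mono fun θ => lintegral_mono fun θ' => ?_
          calc overlap κ θ θ' ^ (m + 1) = overlap κ θ θ' ^ m * overlap κ θ θ' := pow_succ _ _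
            _ ≤ ENNReal.ofReal (ratioR κ) ^ m * overlap κ θ θ' :=
              mul_le_mul_left (pow_le_pow_left' (overlap_le κ θ θ') m) _
      _ = ENNReal.ofReal (ratioR κ) ^ m := by
          have hin (θ : ℝ) : ∫⁻ θ', ENNReal.ofReal (ratioR κ) ^ m * overlap κ θ θ' ∂uniformAngle =
              ENNReal.ofReal (ratioR κ) ^ m * ∫⁻ θ', overlap κ θ θ' ∂uniformAngle :=
            lintegral_const_mul _ (by fun_prop)
          have hout : Measurable fun θ => ∫⁻ θ', overlap κ θ θ' ∂uniformAngle := by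
            refine Measurable.lintegral_prod_right' (f := fun q : ℝ × ℝ => overlap κ q.1 q.2) ?_
            fun_prop
          simp_rw [hin]
          rw [lintegral_const_mul _ hout, lintegral_lintegral_overlap, mul_one]
      _ ≤ ENNReal.ofReal (1 + ratioR κ ^ (m + 1) / ratioR κ) := by
          rw [← ENNReal.ofReal_pow hR0.le]
          refine ENNReal.ofReal_le_ofReal ?_
          rw [pow_succ, mul_div_cancel_right₀ _ hR0.ne']
          linarith

/-- A fixed t-set lies in a random K-set with probability ∏ (K - j)/(N - j) over j < t, and each
factor is at most K/N since K ≤ N. -/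
theorem choose_sub_mul_pow_le {N K t : ℕ} (hK : K ≤ N) (ht : t ≤ K) :
    ((N - t).choose (K - t) : ℝ) ≤ N.choose K * ((K : ℝ) / N) ^ t := by
  induction t with
  | zero => simp
  | succ t ih =>
    have ih := ih (by omega)
    have hN : (0 : ℝ) < N := by exact_mod_cast (by omega : 0 < N)
    obtain ⟨a, ha⟩ : ∃ a, N - t = a + 1 := ⟨N - t - 1, by omega⟩
    obtain ⟨b, hb⟩ : ∃ b, K - t = b + 1 := ⟨K - t - 1, by omega⟩
    have ha' : N - (t + 1) = a := by omega
    have hb' : K - (t + 1) = b := by omega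
    rw [ha, hb] at ih
    rw [ha', hb', pow_succ, ← mul_assoc]
    have h1 : ((a : ℝ) + 1) * a.choose b = (a + 1).choose (b + 1) * (b + 1) := by
      exact_mod_cast Nat.add_one_mul_choose_eq a b
    have haR : (N : ℝ) = t + (a + 1) := by exact_mod_cast (by omega : N = t + (a + 1))
    have hbR : (K : ℝ) = t + (b + 1) := by exact_mod_cast (by omega : K = t + (b + 1))
    have hab : (b : ℝ) ≤ a := by exact_mod_cast (by omega : b ≤ a)
    have h2 : (a.choose b : ℝ) = (a + 1).choose (b + 1) * ((b + 1) / (a + 1)) := by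
      field_simp
      linarith
    have h3 : ((b : ℝ) + 1) / (a + 1) ≤ (K : ℝ) / N := by
      rw [div_le_div_iff₀ (by positivity) hN, haR, hbR]
      nlinarith [(Nat.cast_nonneg t : (0 : ℝ) ≤ t)]
    rw [h2]
    exact mul_le_mul ih h3 (by positivity) (by positivity)

theorem card_filter_subset_powersetCard {N K : ℕ} {T : Finset (Fin N)} (hT : T.card ≤ K) :
    (((Finset.univ : Finset (Fin N)).powersetCard K).filter fun S => T ⊆ S).card =
      (N - T.card).choose (K - T.card) := by
  have h : ((Finset.univ : Finset (Fin N)).powersetCard K).filter (fun S => T ⊆ S) =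
      (Tᶜ.powersetCard (K - T.card)).image fun A => T ∪ A := by
    ext S
    simp only [Finset.mem_filter, Finset.mem_powersetCard, Finset.mem_image]
    constructor
    · rintro ⟨⟨-, hS⟩, hTS⟩
      refine ⟨S \ T, ⟨?_, ?_⟩, Finset.union_sdiff_of_subset hTS⟩
      · intro i hi
        simpa using (Finset.mem_sdiff.1 hi).2
      · rw [Finset.card_sdiff_of_subset hTS, hS]
    · rintro ⟨A, ⟨hA, hAc⟩, rfl⟩
      refine ⟨⟨Finset.subset_univ _, ?_⟩, Finset.subset_union_left⟩
      rw [Finset.card_union_of_disjoint, hAc]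
      · omega
      · exact Finset.disjoint_left.2 fun i hi hi' => by simpa [hi] using hA hi'
  rw [h, Finset.card_image_of_injOn, Finset.card_powersetCard, Finset.card_compl,
    Fintype.card_fin]
  intro A hA B hB hAB
  have hd {C : Finset (Fin N)} (hC : C ∈ (Tᶜ.powersetCard (K - T.card) : Set _)) :
      (T ∪ C) \ T = C := by
    rw [Finset.union_sdiff_left]
    have := (Finset.mem_powersetCard.1 hC).1
    exact Finset.sdiff_eq_self_of_disjoint
      (Finset.disjoint_left.2 fun i hi hi' => by simpa [hi'] using this hi)
  rw [← hd hA, ← hd hB]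
  exact congrArg (· \ T) hAB

/-- With r = 1 + u, the power is a sum of u^|T| over T ⊆ S ∩ S'. Exchanging sums counts the S' that
contain T; bounding this count by (K/N)^|T| gives the binomial value (1 + Ku/N)^K. -/
theorem sum_pow_card_inter_le {N K : ℕ} (hK : K ≤ N) {S : Finset (Fin N)} (hS : S.card = K)
    {r : ℝ} (hr : 1 ≤ r) :
    ∑ S' ∈ (Finset.univ : Finset (Fin N)).powersetCard K, r ^ (S ∩ S').card ≤
      N.choose K * Real.exp ((K : ℝ) ^ 2 / N * (r - 1)) := by
  obtain ⟨u, rfl⟩ : ∃ u, r = u + 1 := ⟨r - 1, by ring⟩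
  have hu : 0 ≤ u := by linarith
  have hexp (A : Finset (Fin N)) : (u + 1) ^ A.card = ∑ T ∈ A.powerset, u ^ T.card := by
    have := Finset.sum_pow_mul_eq_add_pow u 1 A
    simpa using this.symm
  calc ∑ S' ∈ (Finset.univ : Finset (Fin N)).powersetCard K, (u + 1) ^ (S ∩ S').card
      = ∑ S' ∈ (Finset.univ : Finset (Fin N)).powersetCard K, ∑ T ∈ S.powerset,
          if T ⊆ S' then u ^ T.card else 0 := by
        refine Finset.sum_congr rfl fun S' _ => ?_
        rw [hexp, ← Finset.sum_filter]
        refine Finset.sum_congr ?_ fun _ _ => rfl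
        ext T
        simp only [Finset.mem_powerset, Finset.mem_filter, Finset.subset_inter_iff]
    _ = ∑ T ∈ S.powerset, ((N - T.card).choose (K - T.card) : ℝ) * u ^ T.card := by
        rw [Finset.sum_comm]
        refine Finset.sum_congr rfl fun T hT => ?_
        rw [← Finset.sum_filter, Finset.sum_const, nsmul_eq_mul, card_filter_subset_powersetCard
          (hS ▸ Finset.card_le_card (Finset.mem_powerset.1 hT))]
    _ ≤ ∑ T ∈ S.powerset, (N.choose K : ℝ) * ((K : ℝ) / N * u) ^ T.card := by
        refine Finset.sum_le_sum fun T hT => ?_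
        rw [mul_pow, ← mul_assoc]
        exact mul_le_mul_of_nonneg_right (choose_sub_mul_pow_le hK
          (hS ▸ Finset.card_le_card (Finset.mem_powerset.1 hT))) (by positivity)
    _ = N.choose K * ((K : ℝ) / N * u + 1) ^ K := by
        rw [← Finset.mul_sum, ← hS]
        have := Finset.sum_pow_mul_eq_add_pow ((S.card : ℝ) / N * u) 1 S
        simp only [one_pow, mul_one] at this
        rw [this]
    _ ≤ N.choose K * Real.exp ((K : ℝ) / N * u) ^ K := by
        gcongr
        exact Real.add_one_le_exp _
    _ = N.choose K * Real.exp ((K : ℝ) ^ 2 / N * (u + 1 - 1)) := by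
        rw [← Real.exp_nat_mul]
        congr 2
        ring

theorem lintegral_likelihoodRatio_sq_le {N K : ℕ} (hK : K ≤ N) (κ : ℝ) :
    ∫⁻ x, likelihoodRatio N K κ x ^ 2 ∂nullLaw N ≤
      ENNReal.ofReal (1 + Real.exp ((K : ℝ) ^ 2 / N * (ratioR κ - 1)) / ratioR κ) := by
  have hR : 1 ≤ ratioR κ := one_le_ratioR κ
  have hR0 : 0 < ratioR κ := by linarith
  set P := (Finset.univ : Finset (Fin N)).powersetCard K with hP
  set C : ℝ≥0∞ := (N.choose K : ℝ≥0∞) with hC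
  set b : ℝ := 1 + Real.exp ((K : ℝ) ^ 2 / N * (ratioR κ - 1)) / ratioR κ with hb
  have hCpos : (0 : ℝ) < N.choose K := by exact_mod_cast Nat.choose_pos hK
  have hcard : P.card = N.choose K := by simp [hP]
  let F (S : Finset (Fin N)) (x : Fin N → ℝ) : ℝ≥0∞ :=
    ∫⁻ θ, ∏ i ∈ S, relDensity κ θ (x i) ∂uniformAngle
  have hF (S : Finset (Fin N)) : Measurable (F S) := measurable_lintegral_prod_relDensity κ S
  -- The product of two phase averages is a double integral over independent phases; Tonelli then
  -- brings the data integral innermost.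
  have hcross (S S' : Finset (Fin N)) : ∫⁻ x, F S x * F S' x ∂nullLaw N =
      ∫⁻ θ, ∫⁻ θ', overlap κ θ θ' ^ (S ∩ S').card ∂uniformAngle ∂uniformAngle := by
    have h1 (x : Fin N → ℝ) : F S x * F S' x = ∫⁻ θ, ∫⁻ θ',
        (∏ i ∈ S, relDensity κ θ (x i)) * ∏ i ∈ S', relDensity κ θ' (x i)
          ∂uniformAngle ∂uniformAngle := by
      have (θ : ℝ) : ∫⁻ θ', (∏ i ∈ S, relDensity κ θ (x i)) *
          ∏ i ∈ S', relDensity κ θ' (x i) ∂uniformAngle =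
          (∏ i ∈ S, relDensity κ θ (x i)) * F S' x := lintegral_const_mul _ (by fun_prop)
      simp_rw [this]
      rw [lintegral_mul_const _ (by fun_prop)]
    simp_rw [h1]
    rw [lintegral_lintegral_swap]
    · refine lintegral_congr fun θ => ?_
      rw [lintegral_lintegral_swap (by fun_prop)]
      exact lintegral_congr fun θ' => lintegral_prod_mul_prod_relDensity κ S S' θ θ'
    · refine (Measurable.lintegral_prod_right' (f := fun q : ((Fin N → ℝ) × ℝ) × ℝ =>
        (∏ i ∈ S, relDensity κ q.1.2 (q.1.1 i)) * ∏ i ∈ S', relDensity κ q.2 (q.1.1 i))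
        ?_).aemeasurable
      fun_prop
  have hsum (S : Finset (Fin N)) (hS : S ∈ P) :
      ∑ S' ∈ P, ∫⁻ x, F S x * F S' x ∂nullLaw N ≤ C * ENNReal.ofReal b := by
    have hS' : S.card = K := (Finset.mem_powersetCard.1 hS).2
    calc ∑ S' ∈ P, ∫⁻ x, F S x * F S' x ∂nullLaw N
        ≤ ∑ S' ∈ P, ENNReal.ofReal (1 + ratioR κ ^ (S ∩ S').card / ratioR κ) :=
          Finset.sum_le_sum fun S' _ => (hcross S S').le.trans (lintegral_overlap_pow_le κ _)
      _ = ENNReal.ofReal (∑ S' ∈ P, (1 + ratioR κ ^ (S ∩ S').card / ratioR κ)) :=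
          (ENNReal.ofReal_sum_of_nonneg fun _ _ => by positivity).symm
      _ ≤ ENNReal.ofReal (N.choose K * b) := by
          refine ENNReal.ofReal_le_ofReal ?_
          rw [Finset.sum_add_distrib, ← Finset.sum_div, Finset.sum_const, hcard, nsmul_eq_mul, hb,
            mul_add, ← mul_div_assoc]
          gcongr
          exact sum_pow_card_inter_le hK hS' hR
      _ = C * ENNReal.ofReal b := by
          rw [ENNReal.ofReal_mul hCpos.le, ENNReal.ofReal_natCast]
  calc ∫⁻ x, likelihoodRatio N K κ x ^ 2 ∂nullLaw N
      = ∫⁻ x, C⁻¹ * (C⁻¹ * ∑ S ∈ P, ∑ S' ∈ P, F S x * F S' x) ∂nullLaw N := by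
        refine lintegral_congr fun x => ?_
        change (C⁻¹ * ∑ S ∈ P, F S x) ^ 2 = _
        rw [← Finset.sum_mul_sum]
        ring
    _ = C⁻¹ * (C⁻¹ * ∑ S ∈ P, ∑ S' ∈ P, ∫⁻ x, F S x * F S' x ∂nullLaw N) := by
        have h2 (S S' : Finset (Fin N)) : Measurable fun x => F S x * F S' x :=
          (hF S).mul (hF S')
        have h3 (S : Finset (Fin N)) : Measurable fun x => ∑ S' ∈ P, F S x * F S' x :=
          Finset.measurable_fun_sum _ fun S' _ => h2 S S'
        have h4 : Measurable fun x => ∑ S ∈ P, ∑ S' ∈ P, F S x * F S' x :=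
          Finset.measurable_fun_sum _ fun S _ => h3 S
        rw [lintegral_const_mul _ (h4.const_mul _), lintegral_const_mul _ h4,
          lintegral_finsetSum _ fun S _ => h3 S]
        congr 2
        exact Finset.sum_congr rfl fun S _ => lintegral_finsetSum _ fun S' _ => h2 S S'
    _ ≤ C⁻¹ * (C⁻¹ * ∑ S ∈ P, C * ENNReal.ofReal b) := by
        gcongr with S hS
        exact hsum S hS
    _ = (C⁻¹ * C) * ((C⁻¹ * C) * ENNReal.ofReal b) := by
        rw [Finset.sum_const, hcard, nsmul_eq_mul]
        ring
    _ = ENNReal.ofReal b := by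
        rw [hC, choose_inv_mul_choose hK, one_mul, one_mul]

/-! ### Impossibility of weak detection -/

theorem sq_withDensity_sub_le {α : Type*} [MeasurableSpace α] {Q : Measure α}
    [IsProbabilityMeasure Q] {ℓ : α → ℝ≥0∞} (hℓ : Measurable ℓ)
    [IsProbabilityMeasure (Q.withDensity ℓ)] {ε : ℝ} (hε : 0 ≤ ε)
    (h : ∫⁻ x, ℓ x ^ 2 ∂Q ≤ ENNReal.ofReal (1 + ε)) {A : Set α} (hA : MeasurableSet A) :
    ((Q.withDensity ℓ).real A - Q.real A) ^ 2 ≤ ε := by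
  have h1 : ∫⁻ x, ℓ x ∂Q = 1 := by
    have := measure_univ (μ := Q.withDensity ℓ)
    rwa [withDensity_apply _ MeasurableSet.univ, setLIntegral_univ] at this
  have hfin : ∀ᵐ x ∂Q, ℓ x < ∞ := ae_lt_top hℓ (by simp [h1])
  set L : α → ℝ := fun x => (ℓ x).toReal with hL
  have hLi : Integrable L Q := integrable_toReal_of_lintegral_ne_top hℓ.aemeasurable (by simp [h1])
  have hL2 : (fun x => L x ^ 2) = fun x => (ℓ x ^ 2).toReal := by
    funext x
    rw [ENNReal.toReal_pow]
  have hL2i : Integrable (fun x => L x ^ 2) Q := by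
    rw [hL2]
    exact integrable_toReal_of_lintegral_ne_top (hℓ.pow_const 2).aemeasurable
      (ne_top_of_le_ne_top ENNReal.ofReal_ne_top h)
  have hI1 : ∫ x, L x ∂Q = 1 := by
    rw [hL, integral_toReal hℓ.aemeasurable hfin, h1, ENNReal.toReal_one]
  have hI2 : ∫ x, L x ^ 2 ∂Q ≤ 1 + ε := by
    rw [hL2, integral_toReal (hℓ.pow_const 2).aemeasurable
      (hfin.mono fun x hx => ENNReal.pow_lt_top hx)]
    exact ENNReal.toReal_le_of_le_ofReal (by linarith) h
  have hp : (Q.withDensity ℓ).real A = ∫ x in A, L x ∂Q := by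
    rw [measureReal_def, withDensity_apply _ hA,
      integral_toReal hℓ.aemeasurable (ae_restrict_of_ae hfin)]
  set p := (Q.withDensity ℓ).real A
  set q := Q.real A with hq
  have hq1 : q ≤ 1 := measureReal_le_one
  set d := p - q with hd
  -- The expression is (L - 1 - d·1_A)². Its integral is E(L - 1)² - 2d² + d²q, so d²(2 - q) ≤ ε,
  -- and q ≤ 1 finishes.
  have hpt (x : α) : 0 ≤ L x ^ 2 - 2 * L x + 1 +
      A.indicator (fun x => d ^ 2 + 2 * d - 2 * d * L x) x := by
    by_cases hx : x ∈ A
    · rw [Set.indicator_of_mem hx]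
      nlinarith [sq_nonneg (L x - 1 - d)]
    · rw [Set.indicator_of_notMem hx]
      nlinarith [sq_nonneg (L x - 1)]
  have hint := integral_nonneg_of_ae (μ := Q) (ae_of_all _ hpt)
  have hc (c : ℝ) : Integrable (fun _ : α => c) Q := integrable_const c
  have hAi : Integrable (A.indicator fun x => d ^ 2 + 2 * d - 2 * d * L x) Q :=
    ((hc _).sub (hLi.const_mul _)).indicator hA
  have hi1 : Integrable (fun x => L x ^ 2 - 2 * L x) Q := hL2i.sub (hLi.const_mul 2)
  have hi2 : Integrable (fun x => L x ^ 2 - 2 * L x + 1) Q := hi1.add (hc 1)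
  rw [integral_add hi2 hAi, integral_add hi1 (hc 1), integral_sub hL2i (hLi.const_mul 2),
    integral_const_mul, hI1, integral_indicator hA,
    integral_sub (hc _).integrableOn (hLi.const_mul _).integrableOn, integral_const_mul,
    ← hp] at hint
  simp only [integral_const, probReal_univ, smul_eq_mul, measureReal_restrict_apply_univ,
    ← hq] at hint
  have hpd : p = d + q := by rw [hd]; ring
  rw [hpd] at hint
  nlinarith [mul_nonneg (sq_nonneg d) (sub_nonneg.2 hq1)]

theorem weakDetectionImpossible_of_tendsto (K : ℕ → ℕ) (κ : ℕ → ℝ) (hK : ∀ N, K N ≤ N)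
    (h : Tendsto (fun N : ℕ => (K N : ℝ) ^ 2 / N * (ratioR (κ N) - 1) - Real.log (ratioR (κ N)))
      atTop atBot) :
    WeakDetectionImpossible (fun N => nullLaw N) (fun N => altLaw N (K N) (κ N)) := by
  intro φ hφ
  set e : ℕ → ℝ := fun N =>
    Real.exp ((K N : ℝ) ^ 2 / N * (ratioR (κ N) - 1) - Real.log (ratioR (κ N))) with he
  have he0 : Tendsto (fun N => √(e N)) atTop (𝓝 0) := by
    have := (Real.tendsto_exp_atBot.comp h).sqrt
    rwa [Real.sqrt_zero] at this
  refine ⟨fun N => √(e N), he0, fun N => ?_⟩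
  have hP := isProbabilityMeasure_altLaw (hK N) (κ N)
  have hR : 0 < ratioR (κ N) := by linarith [one_le_ratioR (κ N)]
  have hA : MeasurableSet {x | φ N x = true} := hφ N (measurableSet_singleton true)
  have hc : {x | φ N x = false} = {x | φ N x = true}ᶜ := by ext; simp
  have hmiss : pMiss (altLaw N (K N) (κ N)) (φ N) =
      1 - (altLaw N (K N) (κ N)).real {x | φ N x = true} := by
    rw [pMiss, hc, probReal_compl_eq_one_sub hA]
  rw [hmiss, pFalseAlarm]
  have hsm := lintegral_likelihoodRatio_sq_le (hK N) (κ N)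
  -- Dividing by R is subtracting log R in the exponent.
  have hee : Real.exp ((K N : ℝ) ^ 2 / N * (ratioR (κ N) - 1)) / ratioR (κ N) = e N := by
    simp only [he, Real.exp_sub, Real.exp_log hR]
  rw [hee] at hsm
  have hPw : IsProbabilityMeasure ((nullLaw N).withDensity (likelihoodRatio N (K N) (κ N))) := by
    rw [← altLaw_eq_withDensity]
    exact hP
  have key := sq_withDensity_sub_le (measurable_likelihoodRatio N (K N) (κ N))
    (Real.exp_pos _).le hsm hA
  rw [← altLaw_eq_withDensity] at key
  have := Real.le_sqrt_of_sq_le key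
  linarith

/-! ### Arcs -/

/-- The endpoints may vary because the relevant windows start at observations. -/
theorem measurableSet_mem_arc {α : Type*} [MeasurableSpace α] {f a b : α → ℝ}
    (hf : Measurable f) (ha : Measurable a) (hb : Measurable b) :
    MeasurableSet {ω | f ω ∈ arc (a ω) (b ω)} := by
  have : {ω | f ω ∈ arc (a ω) (b ω)} =
      ⋃ m : ℤ, {ω | a ω ≤ f ω + 2 * Real.pi * m} ∩ {ω | f ω + 2 * Real.pi * m ≤ b ω} := by
    ext ω
    simp [arc]
  rw [this]
  exact MeasurableSet.iUnion fun m =>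
    (measurableSet_le ha (hf.add_const _)).inter (measurableSet_le (hf.add_const _) hb)

theorem measurableSet_arc (a b : ℝ) : MeasurableSet (arc a b) :=
  measurableSet_mem_arc measurable_id measurable_const measurable_const

theorem arc_add_int_mul (a b : ℝ) (m : ℤ) :
    arc (a + 2 * Real.pi * m) (b + 2 * Real.pi * m) = arc a b := by
  ext x
  constructor
  · rintro ⟨k, h1, h2⟩
    refine ⟨k - m, ?_, ?_⟩ <;> push_cast <;> linarith
  · rintro ⟨k, h1, h2⟩
    refine ⟨k + m, ?_, ?_⟩ <;> push_cast <;> linarith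

theorem sub_mem_arc_iff {a b x t : ℝ} : x - t ∈ arc a b ↔ x ∈ arc (a + t) (b + t) := by
  constructor
  · rintro ⟨k, h1, h2⟩
    exact ⟨k, by linarith, by linarith⟩
  · rintro ⟨k, h1, h2⟩
    exact ⟨k, by linarith, by linarith⟩

theorem add_two_pi_mem_arc_iff {a b x : ℝ} : x + 2 * Real.pi ∈ arc a b ↔ x ∈ arc a b := by
  constructor
  · rintro ⟨k, h1, h2⟩
    refine ⟨k + 1, ?_, ?_⟩ <;> push_cast <;> linarith
  · rintro ⟨k, h1, h2⟩
    refine ⟨k - 1, ?_, ?_⟩ <;> push_cast <;> linarith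

theorem indicator_arc_sub (F : ℝ → ℝ≥0∞) (a b t x : ℝ) :
    (arc a b).indicator F (x - t) = (arc (a + t) (b + t)).indicator (fun y => F (y - t)) x := by
  by_cases h : x ∈ arc (a + t) (b + t)
  · rw [Set.indicator_of_mem h, Set.indicator_of_mem (sub_mem_arc_iff.2 h)]
  · rw [Set.indicator_of_notMem h, Set.indicator_of_notMem fun h' => h (sub_mem_arc_iff.1 h')]

theorem periodic_indicator_arc {F : ℝ → ℝ≥0∞} (hF : Function.Periodic F (2 * Real.pi)) (a b : ℝ) :
    Function.Periodic ((arc a b).indicator F) (2 * Real.pi) := by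
  intro x
  by_cases h : x ∈ arc a b
  · rw [Set.indicator_of_mem h, Set.indicator_of_mem (add_two_pi_mem_arc_iff.2 h), hF]
  · rw [Set.indicator_of_notMem h,
      Set.indicator_of_notMem fun h' => h (add_two_pi_mem_arc_iff.1 h')]

/-- L < 2π excludes every nonzero number of turns; this is where τ < 1 matters for the mass of an
arc. -/
theorem arc_zero_inter_Ico {L : ℝ} (hL : L < 2 * Real.pi) :
    arc 0 L ∩ Set.Ico 0 (2 * Real.pi) = Set.Icc 0 L := by
  ext x
  constructor
  · rintro ⟨⟨m, h1, h2⟩, h3, h4⟩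
    have hpi := Real.pi_pos
    have hm : m = 0 := by
      rcases lt_trichotomy m 0 with h | h | h
      · have : (m : ℝ) ≤ -1 := by exact_mod_cast Int.le_sub_one_of_lt h
        nlinarith
      · exact h
      · have : (1 : ℝ) ≤ m := by exact_mod_cast h
        nlinarith
    subst hm
    exact ⟨h3, by simpa using h2⟩
  · rintro ⟨h1, h2⟩
    exact ⟨⟨0, by simpa using h1, by simpa using h2⟩, h1, by linarith⟩

theorem uniformAngle_arc (a : ℝ) {τ : ℝ} (hτ : τ ∈ Set.Ioo (0 : ℝ) 1) :
    uniformAngle (arc a (a + 2 * Real.pi * τ)) = ENNReal.ofReal τ := by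
  have hpi := Real.pi_pos
  have h1 : uniformAngle (arc a (a + 2 * Real.pi * τ)) = uniformAngle (arc 0 (2 * Real.pi * τ)) := by
    rw [← lintegral_indicator_one (measurableSet_arc _ _),
      ← lintegral_indicator_one (measurableSet_arc _ _),
      ← lintegral_uniformAngle_comp_sub (periodic_indicator_arc (F := 1) (fun _ => rfl) 0
        (2 * Real.pi * τ)) a]
    simp_rw [indicator_arc_sub, zero_add, add_comm (2 * Real.pi * τ) a]
    rfl
  rw [h1, uniformAngle, Measure.smul_apply, Measure.restrict_apply (measurableSet_arc _ _),
    arc_zero_inter_Ico (by nlinarith [hτ.2]), Real.volume_Icc, smul_eq_mul,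
    ← ENNReal.ofReal_mul (by positivity)]
  congr 1
  field_simp
  ring

theorem vonMises_real_arc (κ θ τ : ℝ) :
    (vonMises θ κ).real (arc (θ - Real.pi * τ) (θ + Real.pi * τ)) = vonMisesMass κ τ := by
  rw [vonMisesMass, measureReal_def, measureReal_def]
  congr 1
  rw [vonMises_eq_withDensity, vonMises_eq_withDensity, withDensity_apply _ (measurableSet_arc _ _),
    withDensity_apply _ (measurableSet_arc _ _), ← lintegral_indicator (measurableSet_arc _ _),
    ← lintegral_indicator (measurableSet_arc _ _), ← lintegral_uniformAngle_comp_sub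
      (periodic_indicator_arc (F := relDensity κ 0)
        (fun x => by simp only [relDensity, sub_zero, Real.cos_add_two_pi]) _ _) θ]
  simp_rw [indicator_arc_sub, neg_add_eq_sub, add_comm (Real.pi * τ) θ, relDensity, sub_zero]
  rfl

/-! ### The interval statistic -/

open Classical in
/-- The number of observations in the arc `[θ, θ + 2πτ]`. -/
noncomputable def windowCount {N : ℕ} (τ : ℝ) (x : Fin N → ℝ) (θ : ℝ) : ℕ :=
  (Finset.univ.filter fun i : Fin N => x i ∈ arc θ (θ + 2 * Real.pi * τ)).card

theorem windowCount_le {N : ℕ} (τ : ℝ) (x : Fin N → ℝ) (θ : ℝ) : windowCount τ x θ ≤ N := by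
  unfold windowCount
  exact (Finset.card_le_univ _).trans_eq (Fintype.card_fin N)

theorem windowCount_le_intervalStat {N : ℕ} (τ : ℝ) (x : Fin N → ℝ) (θ : ℝ) :
    windowCount τ x θ ≤ intervalStat τ x := by
  have hpi : (0 : ℝ) < 2 * Real.pi := by positivity
  obtain ⟨m, hm, -⟩ := existsUnique_add_zsmul_mem_Ico hpi θ 0
  -- A supremum in ℕ over an unbounded set would be 0 by default, so the bound N is essential.
  have hbdd : BddAbove (Set.range fun t : Set.Ico (0 : ℝ) (2 * Real.pi) => windowCount τ x t) :=
    ⟨N, by rintro _ ⟨t, rfl⟩; exact windowCount_le τ x t⟩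
  have h : windowCount τ x θ = windowCount τ x (θ + 2 * Real.pi * m) := by
    unfold windowCount
    rw [add_right_comm θ, arc_add_int_mul]
  rw [h]
  have hm' : θ + 2 * Real.pi * m ∈ Set.Ico (0 : ℝ) (2 * Real.pi) := by
    rwa [zero_add, zsmul_eq_mul, mul_comm (m : ℝ)] at hm
  exact le_ciSup hbdd ⟨_, hm'⟩

theorem exists_intervalStat_eq {N : ℕ} (τ : ℝ) (x : Fin N → ℝ) :
    ∃ θ, intervalStat τ x = windowCount τ x θ := by
  have hbdd : BddAbove (Set.range fun t : Set.Ico (0 : ℝ) (2 * Real.pi) => windowCount τ x t) :=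
    ⟨N, by rintro _ ⟨t, rfl⟩; exact windowCount_le τ x t⟩
  have : Nonempty (Set.Ico (0 : ℝ) (2 * Real.pi)) := ⟨⟨0, le_rfl, by positivity⟩⟩
  obtain ⟨t, ht⟩ := Nat.sSup_mem (Set.range_nonempty _) hbdd
  exact ⟨t, ht.symm⟩

/-- The index i is that of the first observation met in the window: the others follow it within 2πτ.
-/
theorem exists_windowCount_le_self {N : ℕ} (τ : ℝ) (x : Fin N → ℝ) (θ : ℝ)
    (h : 0 < windowCount τ x θ) : ∃ i, windowCount τ x θ ≤ windowCount τ x (x i) := by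
  classical
  set s := Finset.univ.filter fun i : Fin N => x i ∈ arc θ (θ + 2 * Real.pi * τ) with hs
  have hcard : windowCount τ x θ = s.card := by rw [windowCount]
  -- The representative of each observation inside the window makes "first" an ordinary minimum; off
  -- s the value 0 is a dummy.
  have hm (i : Fin N) : ∃ m : ℤ, i ∈ s → x i + 2 * Real.pi * m ∈ Set.Icc θ (θ + 2 * Real.pi * τ) := by
    by_cases hi : i ∈ s
    · obtain ⟨m, hm⟩ := (Finset.mem_filter.1 hi).2
      exact ⟨m, fun _ => hm⟩
    · exact ⟨0, fun h => absurd h hi⟩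
  choose m hm using hm
  obtain ⟨i, his, hi⟩ := s.exists_min_image (fun i => x i + 2 * Real.pi * m i)
    (Finset.card_pos.1 (hcard ▸ h))
  refine ⟨i, ?_⟩
  rw [hcard, windowCount]
  refine Finset.card_le_card fun j hj => Finset.mem_filter.2 ⟨Finset.mem_univ _, m j - m i, ?_⟩
  have h1 := hi j hj
  have h2 := (hm j hj).2
  have h3 := (hm i his).1
  push_cast
  constructor <;> linarith

/-- Reduces the uncountable supremum to N windows, which also makes the test measurable. Positivity
of γ ensures that the optimal window has a first observation. -/
theorem le_intervalStat_iff {N : ℕ} (τ : ℝ) {γ : ℝ} (hγ : 0 < γ) (x : Fin N → ℝ) :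
    γ ≤ intervalStat τ x ↔ ∃ i, γ ≤ windowCount τ x (x i) := by
  constructor
  · intro h
    obtain ⟨θ, hθ⟩ := exists_intervalStat_eq τ x
    rw [hθ] at h
    obtain ⟨i, hi⟩ := exists_windowCount_le_self τ x θ (by exact_mod_cast hγ.trans_le h)
    exact ⟨i, h.trans (by exact_mod_cast hi)⟩
  · rintro ⟨i, hi⟩
    exact hi.trans (by exact_mod_cast windowCount_le_intervalStat τ x (x i))

theorem windowCount_eq_sum {N : ℕ} (τ : ℝ) (x : Fin N → ℝ) (θ : ℝ) :
    (windowCount τ x θ : ℝ) =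
      ∑ i, (arc θ (θ + 2 * Real.pi * τ)).indicator (fun _ => (1 : ℝ)) (x i) := by
  classical
  rw [windowCount, Finset.card_filter, Nat.cast_sum]
  refine Finset.sum_congr rfl fun i _ => ?_
  by_cases h : x i ∈ arc θ (θ + 2 * Real.pi * τ) <;> simp [h]

theorem measurable_windowCount_self {N : ℕ} (τ : ℝ) (i : Fin N) :
    Measurable fun x : Fin N → ℝ => (windowCount τ x (x i) : ℝ) := by
  simp_rw [windowCount_eq_sum]
  refine Finset.measurable_fun_sum _ fun j _ => ?_
  exact Measurable.indicator (f := fun _ : Fin N → ℝ => (1 : ℝ)) measurable_const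
    (measurableSet_mem_arc (f := fun x : Fin N → ℝ => x j) (a := fun x => x i)
      (b := fun x => x i + 2 * Real.pi * τ) (by fun_prop) (by fun_prop) (by fun_prop))

theorem setOf_intervalTest_eq_true (N : ℕ) (τ γ : ℝ) :
    {x | intervalTest N τ γ x = true} = {x | γ ≤ (intervalStat τ x : ℝ)} := by
  ext x
  simp [intervalTest]

theorem setOf_le_intervalStat {N : ℕ} (τ : ℝ) {γ : ℝ} (hγ : 0 < γ) :
    {x : Fin N → ℝ | γ ≤ (intervalStat τ x : ℝ)} = ⋃ i, {x | γ ≤ (windowCount τ x (x i) : ℝ)} := by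
  ext x
  simp [le_intervalStat_iff τ hγ]

theorem measurableSet_le_intervalStat (N : ℕ) (τ γ : ℝ) :
    MeasurableSet {x : Fin N → ℝ | γ ≤ (intervalStat τ x : ℝ)} := by
  rcases le_or_gt γ 0 with hγ | hγ
  · have : {x : Fin N → ℝ | γ ≤ (intervalStat τ x : ℝ)} = Set.univ :=
      Set.eq_univ_of_forall fun x => hγ.trans (Nat.cast_nonneg _)
    rw [this]
    exact MeasurableSet.univ
  · rw [setOf_le_intervalStat τ hγ]
    exact MeasurableSet.iUnion fun i =>
      measurableSet_le measurable_const (measurable_windowCount_self τ i)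

theorem measurable_intervalTest (N : ℕ) (τ γ : ℝ) : Measurable (intervalTest N τ γ) := by
  refine measurable_to_bool ?_
  change MeasurableSet {x | intervalTest N τ γ x = true}
  rw [setOf_intervalTest_eq_true]
  exact measurableSet_le_intervalStat N τ γ

/-! ### False alarms -/

theorem ofReal_exp_mul_windowCount {N : ℕ} (τ : ℝ) (x : Fin N → ℝ) (θ : ℝ) {l : ℝ} (hl : 0 ≤ l) :
    ENNReal.ofReal (Real.exp (l * windowCount τ x θ)) =
      ∏ i, (1 + (arc θ (θ + 2 * Real.pi * τ)).indicator
        (fun _ => ENNReal.ofReal (Real.exp l - 1)) (x i)) := by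
  rw [windowCount_eq_sum, Finset.mul_sum, Real.exp_sum,
    ENNReal.ofReal_prod_of_nonneg fun _ _ => (Real.exp_pos _).le]
  refine Finset.prod_congr rfl fun i _ => ?_
  have h1 : (0 : ℝ) ≤ Real.exp l - 1 := by linarith [Real.one_le_exp hl]
  by_cases h : x i ∈ arc θ (θ + 2 * Real.pi * τ)
  · rw [Set.indicator_of_mem h, Set.indicator_of_mem h, mul_one, ← ENNReal.ofReal_one,
      ← ENNReal.ofReal_add zero_le_one h1]
    congr 1
    ring
  · simp [Set.indicator_of_notMem h]

/-- Given X_i = a, the point a itself contributes exp l, and each of the n others contributes 1 +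
τ(exp l - 1) ≤ exp(τ(exp l - 1)), independently. -/
theorem lintegral_exp_mul_windowCount_le {n : ℕ} {τ : ℝ} (hτ : τ ∈ Set.Ioo (0 : ℝ) 1)
    (i : Fin (n + 1)) {l : ℝ} (hl : 0 ≤ l) :
    ∫⁻ x, ENNReal.ofReal (Real.exp (l * windowCount τ x (x i))) ∂nullLaw (n + 1) ≤
      ENNReal.ofReal (Real.exp (l + n * τ * (Real.exp l - 1))) := by
  have h1 : (0 : ℝ) ≤ Real.exp l - 1 := by linarith [Real.one_le_exp hl]
  set c : ℝ≥0∞ := ENNReal.ofReal (Real.exp l - 1) with hc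
  let g (a y : ℝ) : ℝ≥0∞ := 1 + (arc a (a + 2 * Real.pi * τ)).indicator (fun _ => c) y
  have hg (a : ℝ) : Measurable (g a) := by
    have h : Measurable ((arc a (a + 2 * Real.pi * τ)).indicator fun _ => c) :=
      measurable_const.indicator (measurableSet_arc _ _)
    exact h.const_add 1
  have hg2 : Measurable fun p : ℝ × ℝ => g p.1 p.2 := by
    refine Measurable.const_add (f := fun p : ℝ × ℝ =>
      (arc p.1 (p.1 + 2 * Real.pi * τ)).indicator (fun _ => c) p.2) ?_ 1
    exact Measurable.indicator (f := fun _ : ℝ × ℝ => c) measurable_const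
      (measurableSet_mem_arc (f := fun p : ℝ × ℝ => p.2) (a := fun p => p.1)
        (b := fun p => p.1 + 2 * Real.pi * τ) (by fun_prop) (by fun_prop) (by fun_prop))
  have hgi (a : ℝ) : ∫⁻ y, g a y ∂uniformAngle ≤ ENNReal.ofReal (Real.exp (τ * (Real.exp l - 1))) := by
    have : ∫⁻ y, g a y ∂uniformAngle = 1 + c * ENNReal.ofReal τ := by
      rw [lintegral_add_left measurable_const, lintegral_indicator_const (measurableSet_arc _ _),
        uniformAngle_arc a hτ]
      simp
    rw [this, hc, ← ENNReal.ofReal_mul h1, ← ENNReal.ofReal_one,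
      ← ENNReal.ofReal_add zero_le_one (mul_nonneg h1 hτ.1.le)]
    refine ENNReal.ofReal_le_ofReal ?_
    linarith [Real.add_one_le_exp (τ * (Real.exp l - 1))]
  have hself (a : ℝ) : g a a = ENNReal.ofReal (Real.exp l) := by
    have : a ∈ arc a (a + 2 * Real.pi * τ) :=
      ⟨0, by simp, by have := Real.pi_pos; have := hτ.1; simp; positivity⟩
    simp only [g, Set.indicator_of_mem this, hc]
    rw [← ENNReal.ofReal_one, ← ENNReal.ofReal_add zero_le_one h1]
    congr 1
    ring
  let G (p : ℝ × (Fin n → ℝ)) : ℝ≥0∞ := ENNReal.ofReal (Real.exp l) * ∏ j, g p.1 (p.2 j)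
  have hG : Measurable G := by
    refine measurable_const.mul (Finset.measurable_fun_prod _ fun j _ => ?_)
    exact hg2.comp (measurable_fst.prodMk ((measurable_pi_apply j).comp measurable_snd))
  have hmp := measurePreserving_piFinSuccAbove (fun _ : Fin (n + 1) => uniformAngle) i
  calc ∫⁻ x, ENNReal.ofReal (Real.exp (l * windowCount τ x (x i))) ∂nullLaw (n + 1)
      = ∫⁻ x, G (MeasurableEquiv.piFinSuccAbove (fun _ => ℝ) i x) ∂nullLaw (n + 1) := by
        refine lintegral_congr fun x => ?_
        rw [ofReal_exp_mul_windowCount τ x (x i) hl, Fin.prod_univ_succAbove _ i]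
        change g (x i) (x i) * _ = _
        rw [hself]
        rfl
    _ = ∫⁻ p, G p ∂(uniformAngle.prod (nullLaw n)) := hmp.lintegral_comp hG
    _ = ∫⁻ a, ∫⁻ y, G (a, y) ∂nullLaw n ∂uniformAngle := lintegral_prod _ hG.aemeasurable
    _ ≤ ∫⁻ _, ENNReal.ofReal (Real.exp (l + n * τ * (Real.exp l - 1))) ∂uniformAngle := by
        refine lintegral_mono fun a => ?_
        have hgm : Measurable fun y : Fin n → ℝ => ∏ j, g a (y j) :=
          Finset.measurable_fun_prod _ fun j _ => (hg a).comp (measurable_pi_apply j)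
        change ∫⁻ y, ENNReal.ofReal (Real.exp l) * ∏ j, g a (y j) ∂nullLaw n ≤ _
        rw [lintegral_const_mul _ hgm, nullLaw, lintegral_pi_prod _ (fun _ => g a) fun _ => hg a,
          Finset.prod_const, Finset.card_univ, Fintype.card_fin, Real.exp_add,
          ENNReal.ofReal_mul (Real.exp_pos _).le, mul_assoc (n : ℝ), Real.exp_nat_mul,
          ENNReal.ofReal_pow (Real.exp_pos _).le]
        gcongr
        exact hgi a
    _ = _ := by simp

theorem nullLaw_le_windowCount {n : ℕ} {τ γ : ℝ} (hτ : τ ∈ Set.Ioo (0 : ℝ) 1)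
    (i : Fin (n + 1)) {l : ℝ} (hl : 0 ≤ l) :
    nullLaw (n + 1) {x | γ ≤ (windowCount τ x (x i) : ℝ)} ≤
      ENNReal.ofReal (Real.exp (n * τ * (Real.exp l - 1) - l * (γ - 1))) := by
  set A : Set (Fin (n + 1) → ℝ) := {x | γ ≤ (windowCount τ x (x i) : ℝ)} with hA
  have hmeas : Measurable fun x : Fin (n + 1) → ℝ =>
      ENNReal.ofReal (Real.exp (l * windowCount τ x (x i))) :=
    ((measurable_windowCount_self τ i).const_mul l).exp.ennreal_ofReal
  have hmk := mul_meas_ge_le_lintegral (μ := nullLaw (n + 1)) hmeas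
    (ENNReal.ofReal (Real.exp (l * γ)))
  have hsub : A ⊆ {x | ENNReal.ofReal (Real.exp (l * γ)) ≤
      ENNReal.ofReal (Real.exp (l * windowCount τ x (x i)))} := fun x hx =>
    ENNReal.ofReal_le_ofReal (Real.exp_le_exp.2 (mul_le_mul_of_nonneg_left hx hl))
  have h1 : ENNReal.ofReal (Real.exp (l * γ)) * nullLaw (n + 1) A ≤
      ENNReal.ofReal (Real.exp (l + n * τ * (Real.exp l - 1))) :=
    (mul_le_mul_right (measure_mono hsub) _).trans
      (hmk.trans (lintegral_exp_mul_windowCount_le hτ i hl))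
  have h2 : Real.exp (n * τ * (Real.exp l - 1) - l * (γ - 1)) =
      Real.exp (-(l * γ)) * Real.exp (l + n * τ * (Real.exp l - 1)) := by
    rw [← Real.exp_add]
    congr 1
    ring
  calc nullLaw (n + 1) A = ENNReal.ofReal (Real.exp (-(l * γ))) *
        (ENNReal.ofReal (Real.exp (l * γ)) * nullLaw (n + 1) A) := by
        rw [← mul_assoc, ← ENNReal.ofReal_mul (Real.exp_pos _).le, ← Real.exp_add, neg_add_cancel,
          Real.exp_zero, ENNReal.ofReal_one, one_mul]
    _ ≤ _ := by
        rw [h2, ENNReal.ofReal_mul (Real.exp_pos _).le]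
        gcongr

/-- The value l = log(1 + t/μ) minimises the Poisson exponent; log(1 + u) ≥ 2u/(2 + u) turns the
minimum into a rational bound. -/
theorem chernoff_exponent_le {μ t : ℝ} (hμ : 0 < μ) (ht : 0 ≤ t) :
    μ * (Real.exp (Real.log (1 + t / μ)) - 1) - Real.log (1 + t / μ) * (μ + t) ≤
      -(t ^ 2 / (2 * μ + t)) := by
  have h0 : 0 ≤ t / μ := by positivity
  rw [Real.exp_log (by positivity)]
  have h1 := Real.le_log_one_add_of_nonneg h0
  have h2 : 2 * (t / μ) / (t / μ + 2) = 2 * t / (2 * μ + t) := by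
    field_simp
    ring
  rw [h2] at h1
  have h3 : 2 * t / (2 * μ + t) * (μ + t) ≤ Real.log (1 + t / μ) * (μ + t) :=
    mul_le_mul_of_nonneg_right h1 (by positivity)
  have h4 : μ * (1 + t / μ - 1) - 2 * t / (2 * μ + t) * (μ + t) = -(t ^ 2 / (2 * μ + t)) := by
    field_simp
    ring
  linarith

theorem pFalseAlarm_intervalTest_le {N : ℕ} (hN : 2 ≤ N) {τ γ s : ℝ}
    (hτ : τ ∈ Set.Ioo (0 : ℝ) 1) (hγ : 1 + ((N : ℝ) - 1) * τ ≤ γ) (hs : γ = N * τ + s) :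
    pFalseAlarm (nullLaw N) (intervalTest N τ γ) ≤
      Real.exp (2 - (s ^ 2 / (2 * N * τ + s) - Real.log N)) := by
  obtain ⟨n, rfl⟩ : ∃ n, N = n + 1 := ⟨N - 1, by omega⟩
  have hn : (1 : ℝ) ≤ n := by exact_mod_cast (by omega : 1 ≤ n)
  obtain ⟨hτ0, hτ1⟩ := hτ
  push_cast at hγ hs ⊢
  rw [add_sub_cancel_right] at hγ
  set μ : ℝ := n * τ with hμ
  have hμ0 : 0 < μ := by positivity
  -- The excess of the threshold over the mean count of the other n points, once the window's own
  -- point is removed; the lower bound on γ says t ≥ 0.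
  set t : ℝ := γ - 1 - μ with ht
  have ht0 : 0 ≤ t := by linarith
  have hts : t = s - (1 - τ) := by rw [ht, hs, hμ]; ring
  have hs0 : 0 < s := by linarith
  set l : ℝ := Real.log (1 + t / μ) with hl
  have hl0 : 0 ≤ l := Real.log_nonneg (by have : 0 ≤ t / μ := by positivity
                                          linarith)
  have hexp : n * τ * (Real.exp l - 1) - l * (γ - 1) ≤ 2 - s ^ 2 / (2 * (n + 1) * τ + s) := by
    have h1 := chernoff_exponent_le hμ0 ht0
    have h2 : γ - 1 = μ + t := by rw [ht]; ring
    -- Passing from t = s - (1 - τ) to s costs at most 2s(1 - τ) in the numerator, hence at most 2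
    -- after division by a denominator that exceeds s.
    have h3 : s ^ 2 / (2 * (n + 1) * τ + s) - 2 ≤ t ^ 2 / (2 * μ + t) := by
      have hD : 0 < 2 * (n + 1) * τ + s := by positivity
      calc s ^ 2 / (2 * (n + 1) * τ + s) - 2 ≤ t ^ 2 / (2 * (n + 1) * τ + s) := by
            rw [div_sub' hD.ne', div_le_div_iff_of_pos_right hD, hts]
            nlinarith [mul_pos hs0 hτ0, mul_pos (by linarith : (0 : ℝ) < n + 1) hτ0,
              sq_nonneg (1 - τ)]
        _ ≤ t ^ 2 / (2 * μ + t) := by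
            refine div_le_div_of_nonneg_left (sq_nonneg t) (by positivity) ?_
            rw [hts, hμ]
            nlinarith
    rw [h2]
    linarith
  have hγ0 : 0 < γ := by linarith
  have hmain : nullLaw (n + 1) {x | γ ≤ (intervalStat τ x : ℝ)} ≤
      ENNReal.ofReal (((n : ℝ) + 1) * Real.exp (2 - s ^ 2 / (2 * (n + 1) * τ + s))) := by
    rw [setOf_le_intervalStat τ hγ0]
    refine (measure_iUnion_fintype_le _ _).trans ?_
    calc _ ≤ ∑ _i : Fin (n + 1), ENNReal.ofReal (Real.exp (2 - s ^ 2 / (2 * (n + 1) * τ + s))) :=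
          Finset.sum_le_sum fun i _ => (nullLaw_le_windowCount ⟨hτ0, hτ1⟩ i hl0).trans
            (ENNReal.ofReal_le_ofReal (Real.exp_le_exp.2 hexp))
      _ = _ := by
          rw [Finset.sum_const, Finset.card_univ, Fintype.card_fin, nsmul_eq_mul,
            ENNReal.ofReal_mul (by positivity)]
          congr 1
          rw [← ENNReal.ofReal_natCast]
          push_cast
          rfl
  rw [pFalseAlarm, setOf_intervalTest_eq_true, measureReal_def]
  refine (ENNReal.toReal_le_of_le_ofReal (by positivity) hmain).trans_eq ?_
  have hn1 : (0 : ℝ) < n + 1 := by positivity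
  nth_rewrite 1 [← Real.exp_log hn1]
  rw [← Real.exp_add]
  congr 1
  ring

/-! ### Misses -/

theorem pi_sum_indicator_lt_le {ι : Type*} [Fintype ι] {α : Type*} [MeasurableSpace α]
    (μ : ι → Measure α) [∀ i, IsProbabilityMeasure (μ i)] {A : Set α} (hA : MeasurableSet A)
    {m c : ℝ} (hm : ∑ i, (μ i).real A = m) (hm0 : 0 < m) (hc : 0 < c) :
    Measure.pi μ {x | ∑ i, A.indicator (fun _ => (1 : ℝ)) (x i) < m - c * √m} ≤
      ENNReal.ofReal (1 / c ^ 2) := by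
  let X (i : ι) : α → ℝ := A.indicator fun _ => (1 : ℝ)
  have hX (i : ι) : MemLp (X i) 2 (μ i) := (memLp_const (1 : ℝ)).indicator hA
  have hXe (i : ι) : MemLp (fun x : ι → α => X i (x i)) 2 (Measure.pi μ) :=
    (hX i).comp_measurePreserving (measurePreserving_eval μ i)
  have hint (i : ι) : ∫ y, X i y ∂μ i = (μ i).real A := by
    simp [X, integral_indicator_const, hA]
  have hmean : ∫ x, (∑ i, fun x : ι → α => X i (x i)) x ∂Measure.pi μ = m := by
    simp only [Finset.sum_apply]
    rw [integral_finsetSum _ fun i _ => (hXe i).integrable (by norm_num), ← hm]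
    refine Finset.sum_congr rfl fun i _ => ?_
    rw [← hint i, ← (measurePreserving_eval μ i).map_eq, integral_map
      (measurable_pi_apply i).aemeasurable (by
        rw [(measurePreserving_eval μ i).map_eq]; exact (hX i).aestronglyMeasurable)]
  have hvar : ProbabilityTheory.variance (∑ i, fun x : ι → α => X i (x i)) (Measure.pi μ) ≤ m := by
    rw [ProbabilityTheory.variance_sum_pi hX, ← hm]
    refine Finset.sum_le_sum fun i _ => ?_
    -- An indicator equals its square, so its variance is at most its mean.
    refine (ProbabilityTheory.variance_le_expectation_sq (hX i).aestronglyMeasurable).trans_eq ?_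
    rw [← hint i]
    congr 1
    funext y
    by_cases h : y ∈ A <;> simp [X, h]
  have hsq : 0 < √m := Real.sqrt_pos.2 hm0
  have hch := ProbabilityTheory.meas_ge_le_variance_div_sq (μ := Measure.pi μ)
    (memLp_finsetSum' Finset.univ fun i _ => hXe i) (c := c * √m) (by positivity)
  rw [hmean] at hch
  refine (measure_mono ?_).trans (hch.trans (ENNReal.ofReal_le_ofReal ?_))
  · intro x hx
    simp only [Set.mem_ofPred_eq, Finset.sum_apply] at hx ⊢
    rw [abs_sub_comm]
    exact le_trans (by linarith) (le_abs_self _)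
  · rw [mul_pow, Real.sq_sqrt hm0.le, div_le_div_iff₀ (by positivity) (by positivity)]
    nlinarith [sq_nonneg c]

theorem plantedLaw_intervalStat_lt_le {N K : ℕ} (κ : ℝ) {S : Finset (Fin N)} (hS : S.card = K)
    (θ : ℝ) {τ c : ℝ} (hτ : τ ∈ Set.Ioo (0 : ℝ) 1) (hm : 0 < N * τ + gain K κ τ) (hc : 0 < c) :
    plantedLaw N κ S θ {x | (intervalStat τ x : ℝ) < threshold N K κ τ c} ≤
      ENNReal.ofReal (1 / c ^ 2) := by
  classical
  -- The window starting at a is centred at the planted phase: planted points hit it with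
  -- probability p_κ(τ), the others with probability τ.
  set a : ℝ := θ - Real.pi * τ with ha
  set A : Set ℝ := arc a (a + 2 * Real.pi * τ) with hA
  let μ (i : Fin N) : Measure ℝ := if i ∈ S then vonMises θ κ else uniformAngle
  have hμ (i : Fin N) : IsProbabilityMeasure (μ i) := by
    simp only [μ]
    split_ifs <;> infer_instance
  have hlaw : plantedLaw N κ S θ = Measure.pi μ := by
    rw [plantedLaw]
  have hsum : ∑ i, (μ i).real A = N * τ + gain K κ τ := by
    have h1 (i : Fin N) : (μ i).real A = τ + if i ∈ S then vonMisesMass κ τ - τ else 0 := by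
      by_cases hi : i ∈ S
      · simp only [μ, hi, if_true]
        rw [← vonMises_real_arc κ θ τ, hA, ha]
        rw [show θ - Real.pi * τ + 2 * Real.pi * τ = θ + Real.pi * τ by ring]
        ring
      · simp only [μ, hi, if_false]
        rw [hA, measureReal_def, uniformAngle_arc a hτ, ENNReal.toReal_ofReal hτ.1.le, add_zero]
    simp_rw [h1]
    rw [Finset.sum_add_distrib, Finset.sum_ite_mem, Finset.univ_inter, Finset.sum_const,
      Finset.sum_const, hS, gain]
    simp
  rw [hlaw]
  refine (measure_mono ?_).trans
    (pi_sum_indicator_lt_le μ (measurableSet_arc a (a + 2 * Real.pi * τ)) hsum hm hc)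
  intro x hx
  simp only [Set.mem_ofPred_eq] at hx ⊢
  rw [← windowCount_eq_sum]
  refine lt_of_le_of_lt ?_ hx
  exact_mod_cast windowCount_le_intervalStat τ x a

theorem pMiss_intervalTest_le {N K : ℕ} (hK : K ≤ N) (κ : ℝ) {τ c : ℝ}
    (hτ : τ ∈ Set.Ioo (0 : ℝ) 1) (hm : 0 < N * τ + gain K κ τ) (hc : 0 < c) :
    pMiss (altLaw N K κ) (intervalTest N τ (threshold N K κ τ c)) ≤ 1 / c ^ 2 := by
  have hset : {x | intervalTest N τ (threshold N K κ τ c) x = false} =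
      {x | threshold N K κ τ c ≤ (intervalStat τ x : ℝ)}ᶜ := by
    ext x
    simp [intervalTest]
  rw [pMiss, hset, measureReal_def]
  refine ENNReal.toReal_le_of_le_ofReal (by positivity) ?_
  refine altLaw_apply_le hK κ (measurableSet_le_intervalStat N τ _).compl fun S hS θ => ?_
  have : {x : Fin N → ℝ | threshold N K κ τ c ≤ (intervalStat τ x : ℝ)}ᶜ =
      {x | (intervalStat τ x : ℝ) < threshold N K κ τ c} := by
    ext x
    simp
  rw [this]
  exact plantedLaw_intervalStat_lt_le κ hS θ hτ hm hc

/-! ### Achievability of strong detection -/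

/-- The quantity equals (N - K)τ + K p_κ(τ). -/
theorem mean_nonneg {N K : ℕ} (hK : K ≤ N) (κ : ℝ) {τ : ℝ} (hτ : 0 ≤ τ) :
    0 ≤ N * τ + gain K κ τ := by
  have h1 : (0 : ℝ) ≤ vonMisesMass κ τ := measureReal_nonneg
  have h2 : (K : ℝ) ≤ N := by exact_mod_cast hK
  rw [gain]
  nlinarith [mul_nonneg (Nat.cast_nonneg K : (0 : ℝ) ≤ K) h1]

theorem achievesStrongDetection_intervalTest (K : ℕ → ℕ) (κ : ℕ → ℝ) (hK : ∀ N, K N ≤ N)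
    (τ c : ℕ → ℝ) (hτ : ∀ N, τ N ∈ Set.Ioo (0 : ℝ) 1) (hc : Tendsto c atTop atTop)
    (hγ : ∀ᶠ N : ℕ in atTop, 1 + ((N : ℝ) - 1) * τ N ≤ threshold N (K N) (κ N) (τ N) (c N))
    (hg : Tendsto (fun N : ℕ => gain (K N) (κ N) (τ N) ^ 2 / (N * τ N + gain (K N) (κ N) (τ N)))
      atTop atTop)
    (hs : Tendsto (fun N : ℕ =>
      (gain (K N) (κ N) (τ N) - c N * √(N * τ N + gain (K N) (κ N) (τ N))) ^ 2 /
        (2 * N * τ N + gain (K N) (κ N) (τ N) -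
          c N * √(N * τ N + gain (K N) (κ N) (τ N))) - Real.log N) atTop atTop) :
    AchievesStrongDetection (fun N => nullLaw N) (fun N => altLaw N (K N) (κ N))
      (fun N => intervalTest N (τ N) (threshold N (K N) (κ N) (τ N) (c N))) := by
  refine ⟨fun N => measurable_intervalTest N _ _, ?_, ?_⟩
  · have hlim := Real.tendsto_exp_atBot.comp
      (tendsto_const_nhds (x := (2 : ℝ)) |>.add_atBot (tendsto_neg_atTop_atBot.comp hs))
    refine squeeze_zero' (Eventually.of_forall fun N => measureReal_nonneg) ?_ hlim
    filter_upwards [hγ, eventually_ge_atTop 2] with N h1 h2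
    refine (pFalseAlarm_intervalTest_le h2 (hτ N) h1 (s := gain (K N) (κ N) (τ N) -
      c N * √(N * τ N + gain (K N) (κ N) (τ N))) (by rw [threshold]; ring)).trans_eq ?_
    simp only [Function.comp_apply]
    rw [sub_eq_add_neg (2 : ℝ), add_sub_assoc (2 * (N : ℝ) * τ N)]
  · refine squeeze_zero' (Eventually.of_forall fun N => measureReal_nonneg) ?_
      (((tendsto_pow_atTop two_ne_zero).comp hc).const_div_atTop 1)
    filter_upwards [hc.eventually_gt_atTop 0, hg.eventually_gt_atTop 0] with N h1 h2
    refine pMiss_intervalTest_le (hK N) (κ N) (hτ N) ?_ h1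
    -- Since x/0 = 0, a positive value of g²/(Nτ + g) excludes Nτ + g = 0.
    refine lt_of_le_of_ne (mean_nonneg (hK N) (κ N) (hτ N).1.le) fun h => ?_
    rw [← h, div_zero] at h2
    exact lt_irrefl _ h2

end CircularDetection

theorem theorem2 (K : ℕ → ℕ) (κ : ℕ → ℝ) (hK : ∀ N, K N ≤ N) (hκ : ∀ N, 0 < κ N) :
    (∀ τ c : ℕ → ℝ, (∀ N, τ N ∈ Set.Ioo (0 : ℝ) 1) →
      Filter.Tendsto c Filter.atTop Filter.atTop →
      (∀ᶠ N : ℕ in Filter.atTop, 1 + ((N : ℝ) - 1) * τ N ≤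
        CircularDetection.threshold N (K N) (κ N) (τ N) (c N)) →
      Filter.Tendsto
        (fun N : ℕ => CircularDetection.gain (K N) (κ N) (τ N) ^ 2 /
          (N * τ N + CircularDetection.gain (K N) (κ N) (τ N)))
        Filter.atTop Filter.atTop →
      Filter.Tendsto
        (fun N : ℕ =>
          (CircularDetection.gain (K N) (κ N) (τ N) -
              c N * √(N * τ N + CircularDetection.gain (K N) (κ N) (τ N))) ^ 2 /
            (2 * N * τ N + CircularDetection.gain (K N) (κ N) (τ N) -
              c N * √(N * τ N + CircularDetection.gain (K N) (κ N) (τ N))) -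
          Real.log N)
        Filter.atTop Filter.atTop →
      CircularDetection.AchievesStrongDetection
        (fun N => CircularDetection.nullLaw N)
        (fun N => CircularDetection.altLaw N (K N) (κ N))
        (fun N => CircularDetection.intervalTest N (τ N)
          (CircularDetection.threshold N (K N) (κ N) (τ N) (c N)))) ∧
    (Filter.Tendsto
        (fun N : ℕ => (K N : ℝ) ^ 2 / N * (CircularDetection.ratioR (κ N) - 1) -
          Real.log (CircularDetection.ratioR (κ N)))
        Filter.atTop Filter.atBot →
      CircularDetection.WeakDetectionImpossible
        (fun N => CircularDetection.nullLaw N)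
        (fun N => CircularDetection.altLaw N (K N) (κ N))) := by
  exact ⟨fun τ c hτ hc hγ hg hs =>
      CircularDetection.achievesStrongDetection_intervalTest K κ hK τ c hτ hc hγ hg hs,
    CircularDetection.weakDetectionImpossible_of_tendsto K κ hK⟩
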